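/- For a Boolean ring $B$ (a ring with unit in which every element is idempotent), the self-injective dimension of $B$ is the injective dimension of $B$ as a module over itself. For every integer $n \geq 0$ there is a Boolean ring of cardinality $\aleph_n$ whose self-injective dimension is exactly $n+1$. There is also a Boolean ring of cardinality $\aleph_\omega$ whose self-injective dimension is infinite. -/

import Mathlib

universe u

/-! Upper bound. A homomorphism from an ideal with fewer than `ℵ_ n` generators to an `n`-th
cosyzygy is multiplication by an element (`exists_eq_smul_of_mk_lt`). Finitely generated ideals are
principal, which starts an induction; well-ordering the generators gives the step. If `#B ≤ ℵ_ n`,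
every ideal is covered in degree `n + 1`, and Baer's criterion makes that cosyzygy injective.

Lower bound. Given orthogonal families `e 0, …, e n`, a function `f` on the product of their index
sets is glued, one family per degree, to an element of the `(n + 1)`-st cosyzygy. If the injective
dimension is at most `n`, then `f` also represents zero, and unwinding this writes `f` locally as a
sum of functions each ignoring one coordinate (`exists_eq_sum_of_hasInjectiveDimensionLT`). In the
algebra generated by indicators of coordinate points, every element is almost constant along each
coordinate. Evaluating at the point itself would then give a decomposition that cardinalities `ℵ_ 0,
…, ℵ_ n` forbid (`not_forall_sum_eq_prod`). -/

open CategoryTheory Cardinal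

/-! ### Cosyzygies and injective dimension -/

namespace ModuleCat

variable {R : Type u} [Ring R]

/-- The iterated cosyzygies of a module along the chosen embeddings into injective modules. -/
noncomputable def cosyzygy (M : ModuleCat.{u} R) : ℕ → ModuleCat.{u} R
  | 0 => M
  | n + 1 => Limits.cokernel (Injective.ι (cosyzygy M n))

/-- The chosen injective module containing a cosyzygy. -/
noncomputable abbrev cosyzygyHull (M : ModuleCat.{u} R) (n : ℕ) : ModuleCat.{u} R :=
  Injective.under (M.cosyzygy n)

/-- The embedding of a cosyzygy into an injective module. -/
noncomputable def cosyzygyIncl (M : ModuleCat.{u} R) (n : ℕ) :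
    M.cosyzygy n →ₗ[R] M.cosyzygyHull n :=
  (Injective.ι (M.cosyzygy n)).hom

/-- The projection of an injective module onto the next cosyzygy. -/
noncomputable def cosyzygyProj (M : ModuleCat.{u} R) (n : ℕ) :
    M.cosyzygyHull n →ₗ[R] M.cosyzygy (n + 1) :=
  (Limits.cokernel.π (Injective.ι (M.cosyzygy n))).hom

theorem cosyzygy_shortExact (M : ModuleCat.{u} R) (n : ℕ) :
    (ShortComplex.mk _ _ (Limits.cokernel.condition (Injective.ι (M.cosyzygy n)))).ShortExact :=
  { exact := ShortComplex.exact_cokernel _ }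

theorem cosyzygyIncl_injective (M : ModuleCat.{u} R) (n : ℕ) :
    Function.Injective (M.cosyzygyIncl n) :=
  (cosyzygy_shortExact M n).moduleCat_injective_f

theorem cosyzygyProj_surjective (M : ModuleCat.{u} R) (n : ℕ) :
    Function.Surjective (M.cosyzygyProj n) :=
  (cosyzygy_shortExact M n).moduleCat_surjective_g

theorem cosyzygy_exact (M : ModuleCat.{u} R) (n : ℕ) :
    Function.Exact (M.cosyzygyIncl n) (M.cosyzygyProj n) :=
  (ShortComplex.ShortExact.moduleCat_exact_iff_function_exact _).mp (cosyzygy_shortExact M n).exact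

theorem cosyzygyHull_injective (M : ModuleCat.{u} R) (n : ℕ) :
    Module.Injective R (M.cosyzygyHull n) :=
  (Module.injective_iff_injective_object R _).mpr (inferInstanceAs (Injective (M.cosyzygyHull n)))

theorem hasInjectiveDimensionLT_cosyzygy_iff (M : ModuleCat.{u} R) (n k : ℕ) :
    HasInjectiveDimensionLT (M.cosyzygy n) (k + 1) ↔ HasInjectiveDimensionLT M (n + k + 1) := by
  induction n generalizing k with
  | zero => simp [cosyzygy]
  | succ n ih =>
    have h := (cosyzygy_shortExact M n).hasInjectiveDimensionLT_X₃_iff k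
      (inferInstanceAs (Injective (M.cosyzygyHull n)))
    refine h.trans ((ih (k + 1)).trans ?_)
    rw [show n + (k + 1) + 1 = n + 1 + k + 1 by omega]

theorem hasInjectiveDimensionLT_iff_injective_cosyzygy (M : ModuleCat.{u} R) (n : ℕ) :
    HasInjectiveDimensionLT M (n + 1) ↔ Module.Injective R (M.cosyzygy n) := by
  rw [Module.injective_iff_injective_object, injective_iff_hasInjectiveDimensionLT_one]
  exact (hasInjectiveDimensionLT_cosyzygy_iff M n 0).symm

end ModuleCat

/-! ### Upper bound from the cardinality of the ring -/

namespace BooleanRing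

variable {B : Type u} [BooleanRing B]

theorem exists_span_singleton_of_fg {I : Ideal B} (hI : I.FG) : ∃ e : B, I = Ideal.span {e} := by
  have h : IsIdempotentElem I := by
    refine le_antisymm Ideal.mul_le_left fun x hx => ?_
    rw [← BooleanRing.mul_self x]
    exact Ideal.mul_mem_mul hx hx
  obtain ⟨e, -, he⟩ := (I.isIdempotentElem_iff_of_fg hI).mp h
  exact ⟨e, he⟩

/-- Multiplication by the idempotent `t` projects onto the intersection, which therefore needs no
more generators than `S`. -/
theorem span_inf_span_singleton (S : Set B) (t : B) :
    Ideal.span S ⊓ Ideal.span {t} = Ideal.span ((fun s => t * s) '' S) := by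
  apply le_antisymm
  · rintro x ⟨hx, hxt⟩
    obtain ⟨c, rfl⟩ := Ideal.mem_span_singleton.mp hxt
    have h : t * (t * c) ∈ Ideal.span {t} * Ideal.span S :=
      Ideal.mul_mem_mul (Ideal.mem_span_singleton_self t) hx
    rw [← mul_assoc, BooleanRing.mul_self, Ideal.span_mul_span'] at h
    simpa [Set.singleton_mul] using h
  · rw [Ideal.span_le]
    rintro _ ⟨s, hs, rfl⟩
    exact ⟨Ideal.mul_mem_left _ _ (Ideal.subset_span hs),
      Ideal.mul_mem_right _ _ (Ideal.mem_span_singleton_self t)⟩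

/-- Lifting along a surjection a linear map defined on an ideal with well-ordered generators. -/
theorem exists_lift_of_wellOrder {Q Z : Type u} [AddCommGroup Q] [Module B Q] [AddCommGroup Z]
    [Module B Z] (p : Q →ₗ[B] Z) (hp : Function.Surjective p) {W : Type u} [LinearOrder W]
    [WellFoundedLT W] (t : W → B)
    (hK : ∀ a, ∀ h : (Ideal.span (t '' Set.Iio a) ⊓ Ideal.span {t a} : Ideal B) →ₗ[B]
      LinearMap.ker p, ∃ z : LinearMap.ker p, ∀ x, h x = (x : B) • z)
    (f : Ideal.span (Set.range t) →ₗ[B] Z) :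
    ∃ g : Ideal.span (Set.range t) →ₗ[B] Q, ∀ x, p (g x) = f x := by
  let core : (B →ₗ.[B] Q) → Set W := fun g => {a | ∀ b ≤ a, t b ∈ g.domain}
  have core_mono {g g' : B →ₗ.[B] Q} (h : g ≤ g') : core g ⊆ core g' :=
    fun a ha b hb => h.1 (ha b hb)
  -- The domain bound ensures that, if `a` is the first index missing from `core g`, then `g` lives
  -- exactly on the span of the earlier generators, where `hK` applies.
  let S : Set (B →ₗ.[B] Q) := {g | g.domain ≤ Ideal.span (t '' core g) ∧
    ∀ (x : g.domain) (hx : (x : B) ∈ Ideal.span (Set.range t)), p (g x) = f ⟨x, hx⟩}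
  have h0 : (⊥ : B →ₗ.[B] Q) ∈ S := by
    refine ⟨bot_le, fun x hx => ?_⟩
    have hx0 : (x : B) = 0 := (Submodule.mem_bot B).mp x.2
    have e1 : x = 0 := Subtype.ext hx0
    have e2 : (⟨(x : B), hx⟩ : Ideal.span (Set.range t)) = 0 := Subtype.ext hx0
    rw [e2, e1, LinearPMap.map_zero, map_zero, map_zero]
  obtain ⟨g, -, hg⟩ := zorn_le_nonempty₀ S (by
    intro c hcS hc y hy
    have hd : DirectedOn (· ≤ ·) c := hc.directedOn
    refine ⟨LinearPMap.sSup c hd, ⟨?_, ?_⟩, fun z hz => LinearPMap.le_sSup hd hz⟩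
    · intro x hx
      obtain ⟨k, hk, hxk⟩ := (LinearPMap.mem_domain_sSup_iff ⟨y, hy⟩ hd).mp hx
      exact Ideal.span_mono (Set.image_mono (core_mono (LinearPMap.le_sSup hd hk)))
        ((hcS hk).1 hxk)
    · rintro ⟨x, hx⟩ hx'
      obtain ⟨k, hk, hxk⟩ := (LinearPMap.mem_domain_sSup_iff ⟨y, hy⟩ hd).mp hx
      exact (congrArg p (LinearPMap.sSup_apply hd hk ⟨x, hxk⟩)).trans ((hcS hk).2 ⟨x, hxk⟩ hx'))
    ⊥ h0
  have hcore : core g = Set.univ := by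
    by_contra hne
    obtain ⟨a, ha, hmin⟩ := WellFounded.has_min (wellFounded_lt (α := W)) (core g)ᶜ
      (Set.nonempty_compl.mpr hne)
    have hlt : ∀ b < a, b ∈ core g := fun b hb => by
      by_contra h
      exact hmin b h hb
    have hIio : core g = Set.Iio a := by
      ext b
      refine ⟨fun hb => ?_, hlt b⟩
      by_contra h
      exact ha fun c hc => hb c (hc.trans (not_lt.mp h))
    have hdom : g.domain ≤ Ideal.span (t '' Set.Iio a) := hIio ▸ hg.prop.1
    have hdom' : Ideal.span (t '' Set.Iio a) ≤ g.domain := by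
      rw [Ideal.span_le]
      rintro _ ⟨b, hb, rfl⟩
      exact hlt b hb b le_rfl
    have hrange : ∀ b, t b ∈ Ideal.span (Set.range t) := fun b => Ideal.subset_span ⟨b, rfl⟩
    obtain ⟨y₀, hy₀⟩ := hp (f ⟨t a, hrange a⟩)
    have hpy (x : B) (hx : x ∈ Ideal.span {t a}) (hx' : x ∈ Ideal.span (Set.range t)) :
        p (x • y₀) = f ⟨x, hx'⟩ := by
      obtain ⟨c, rfl⟩ := Ideal.mem_span_singleton.mp hx
      rw [map_smul, hy₀, ← map_smul]
      congr 1
      ext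
      change t a * c * t a = t a * c
      rw [mul_right_comm, BooleanRing.mul_self]
    let K : Ideal B := Ideal.span (t '' Set.Iio a) ⊓ Ideal.span {t a}
    have hKr : ∀ x ∈ K, x ∈ Ideal.span (Set.range t) := fun x hx =>
      Ideal.span_mono (Set.image_subset_range _ _) hx.1
    have hKd : K ≤ g.domain := fun x hx => hdom' hx.1
    -- On `K` both `g` and `x ↦ x • y₀` lift `f`, so their difference lands in `ker p`; the `z` from
    -- `hK` corrects `y₀` to agree with `g`.
    let h₀ : K →ₗ[B] Q := g.toFun ∘ₗ Submodule.inclusion hKd -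
      (LinearMap.toSpanSingleton B Q y₀) ∘ₗ K.subtype
    have hh₀ (x : K) : h₀ x = g ⟨x, hKd x.2⟩ - (x : B) • y₀ := rfl
    let h : K →ₗ[B] LinearMap.ker p := h₀.codRestrict _ fun x => by
      rw [LinearMap.mem_ker, hh₀, map_sub, hg.prop.2 _ (hKr _ x.2), hpy _ x.2.2 (hKr _ x.2),
        sub_self]
    obtain ⟨z, hz⟩ := hK a h
    have hz' (x : K) : g ⟨x, hKd x.2⟩ = (x : B) • (y₀ + z) := by
      have := congrArg Subtype.val (hz x)
      change h₀ x = (x : B) • (z : Q) at this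
      rw [hh₀, sub_eq_iff_eq_add] at this
      rw [this, smul_add, add_comm]
    let k : B →ₗ.[B] Q := (LinearMap.toSpanSingleton B Q (y₀ + z)).toPMap (Ideal.span {t a})
    have hk (x : k.domain) : k x = (x : B) • (y₀ + z) := rfl
    have hgk : ∀ (x : g.domain) (y : k.domain), (x : B) = y → g x = k y := by
      rintro ⟨x, hx⟩ ⟨y, hy⟩ hxy
      obtain rfl : x = y := hxy
      rw [hk]
      exact hz' ⟨x, hdom hx, hy⟩
    have hle : g ≤ g.sup k hgk := LinearPMap.left_le_sup _ _ _
    have hkle : k ≤ g.sup k hgk := LinearPMap.right_le_sup _ _ _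
    have hta : t a ∈ k.domain := Ideal.mem_span_singleton_self _
    have ha' : a ∈ core (g.sup k hgk) := fun b hb => by
      rcases hb.lt_or_eq with hb | rfl
      · exact hle.1 (hlt b hb b le_rfl)
      · exact hkle.1 hta
    have hmem : g.sup k hgk ∈ S := by
      refine ⟨?_, ?_⟩
      · rw [LinearPMap.domain_sup]
        refine sup_le (hg.prop.1.trans (Ideal.span_mono (Set.image_mono (core_mono hle)))) ?_
        change Ideal.span {t a} ≤ _
        rw [Ideal.span_singleton_le_iff_mem]
        exact Ideal.subset_span ⟨a, ha', rfl⟩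
      · rintro ⟨x, hx⟩ hx'
        obtain ⟨x₁, hx₁, x₂, hx₂, rfl⟩ := Submodule.mem_sup.mp hx
        have r₁ : x₁ ∈ Ideal.span (Set.range t) :=
          Ideal.span_mono (Set.image_subset_range _ _) (hdom hx₁)
        have r₂ : x₂ ∈ Ideal.span (Set.range t) := by
          rw [← add_sub_cancel_left x₁ x₂]
          exact sub_mem hx' r₁
        refine (congrArg p (LinearPMap.sup_apply hgk ⟨x₁, hx₁⟩ ⟨x₂, hx₂⟩ ⟨x₁ + x₂, hx⟩ rfl)).trans ?_
        rw [map_add, hg.prop.2 _ r₁, hk,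
          smul_add, map_add, hpy _ hx₂ r₂, map_smul p, LinearMap.mem_ker.mp z.2, smul_zero, add_zero,
          ← map_add]
        rfl
    exact ha (core_mono (hg.le_of_ge hmem hle) ha')
  have hle : Ideal.span (Set.range t) ≤ g.domain := by
    rw [Ideal.span_le]
    rintro _ ⟨b, rfl⟩
    exact (hcore ▸ Set.mem_univ b : b ∈ core g) b le_rfl
  exact ⟨g.toFun ∘ₗ Submodule.inclusion hle, fun x => hg.prop.2 (Submodule.inclusion hle x) x.2⟩

theorem exists_eq_smul_of_mk_lt (n : ℕ) (T : Set B) (hT : #T < ℵ_ n) (M : ModuleCat.{u} B)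
    (h : Ideal.span T →ₗ[B] M.cosyzygy n) :
    ∃ z : M.cosyzygy n, ∀ x, h x = (x : B) • z := by
  induction n generalizing T M with
  | zero =>
    have hfin : T.Finite := by
      rw [Nat.cast_zero, aleph_zero] at hT
      exact Set.finite_coe_iff.mp (Cardinal.lt_aleph0_iff_finite.mp hT)
    obtain ⟨e, he⟩ := exists_span_singleton_of_fg (I := Ideal.span T) ⟨hfin.toFinset, by simp⟩
    have hmem : e ∈ Ideal.span T := he ▸ Ideal.mem_span_singleton_self e
    refine ⟨h ⟨e, hmem⟩, fun x => ?_⟩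
    obtain ⟨c, hc⟩ := Ideal.mem_span_singleton.mp (he ▸ x.2 : (x : B) ∈ Ideal.span {e})
    rw [← map_smul]
    congr 1
    ext
    change (x : B) = x * e
    rw [hc, mul_right_comm, BooleanRing.mul_self]
  | succ n ih =>
    have hT' : #T ≤ ℵ_ n := by
      rwa [Nat.cast_succ, ← succ_aleph, Order.lt_succ_iff] at hT
    -- In the order type of the initial ordinal, each proper initial segment has cardinality below
    -- `#T`, so the induction hypothesis handles the obstruction at each stage.
    let W := (#T).ord.ToType
    have hW : #W = #T := Cardinal.mk_ord_toType _
    obtain ⟨eW⟩ := Cardinal.eq.mp hW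
    let t : W → B := fun w => (eW w : B)
    have ht : Set.range t = T := by
      ext x
      exact ⟨fun ⟨w, hw⟩ => hw ▸ (eW w).2, fun hx => ⟨eW.symm ⟨x, hx⟩, by simp [t]⟩⟩
    have hker : ∀ y, y ∈ LinearMap.ker (M.cosyzygyProj n) ↔ ∃ z, M.cosyzygyIncl n z = y :=
      fun y => M.cosyzygy_exact n y
    have key := exists_lift_of_wellOrder (M.cosyzygyProj n) (M.cosyzygyProj_surjective n) t
    rw [ht] at key
    obtain ⟨g, hg⟩ := key (by
      intro a
      rw [span_inf_span_singleton]
      intro k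
      have eqv : M.cosyzygy n ≃ₗ[B] LinearMap.ker (M.cosyzygyProj n) :=
        (LinearEquiv.ofInjective _ (M.cosyzygyIncl_injective n)).trans
          (LinearEquiv.ofEq _ _ (M.cosyzygy_exact n).linearMap_ker_eq.symm)
      obtain ⟨z, hz⟩ := ih _ (((mk_image_le.trans mk_image_le).trans_lt
        ((mk_Iio_lt a (by simp [W])).trans_eq hW)).trans_le hT') M (eqv.symm.toLinearMap ∘ₗ k)
      refine ⟨eqv z, fun x => ?_⟩
      rw [← map_smul, ← hz x]
      simp) h
    obtain ⟨q, hq⟩ := Module.Baer.of_injective (M.cosyzygyHull_injective n) _ g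
    refine ⟨M.cosyzygyProj n (q 1), fun x => ?_⟩
    rw [← hg x, ← hq x x.2, ← map_smul, ← map_smul, smul_eq_mul, mul_one]

theorem injectiveDimension_le_of_mk_le (n : ℕ) (hB : #B ≤ ℵ_ n) (M : ModuleCat.{u} B) :
    injectiveDimension M ≤ ((n + 1 : ℕ) : WithBot ℕ∞) := by
  refine (injectiveDimension_le_iff M (n + 1)).mpr ?_
  refine (M.hasInjectiveDimensionLT_iff_injective_cosyzygy (n + 1)).mpr (Module.Baer.injective ?_)
  intro I g
  have hI : #(I : Set B) < ℵ_ (n + 1 : ℕ) := by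
    rw [Nat.cast_succ, ← succ_aleph, Order.lt_succ_iff]
    exact (mk_set_le _).trans hB
  have key := exists_eq_smul_of_mk_lt (n + 1) (I : Set B) hI M
  rw [Ideal.span_eq] at key
  obtain ⟨z, hz⟩ := key g
  exact ⟨LinearMap.toSpanSingleton B _ z, fun x hx => (hz ⟨x, hx⟩).symm⟩

end BooleanRing

/-! ### Gluing along orthogonal families, and functions representing classes -/

namespace BooleanRing

variable {B : Type u} [BooleanRing B]

/-- A compatible family of elements of an injective module along orthogonal elements of a
Boolean ring is glued to a single element. -/
theorem exists_glue {Q : Type u} [AddCommGroup Q] [Module B Q] (hQ : Module.Injective B Q)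
    {W : Type u} (e : W → B) (he : ∀ a b, a ≠ b → e a * e b = 0) (S : Set B) (x : W → Q)
    (hx : ∀ c ∈ S, ∀ a, c • x a = 0) :
    ∃ q : Q, (∀ c ∈ S, c • q = 0) ∧ ∀ a, e a • q = e a • x a := by
  let J : Ideal B := Ideal.span S
  have hJ : ∀ c ∈ J, ∀ a, c • x a = 0 := fun c hc a => by
    induction hc using Submodule.span_induction with
    | mem c hc => exact hx c hc a
    | zero => exact zero_smul _ _
    | add c d _ _ hc hd => rw [add_smul, hc, hd, add_zero]
    | smul r c _ hc => rw [smul_eq_mul, mul_smul, hc, smul_zero]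
  let σ : (W →₀ B) →ₗ[B] B := Finsupp.linearCombination B e
  -- Extending from a submodule of `B ⧸ J` rather than of `B` forces the glued element, the image of
  -- `1`, to be killed by `S`.
  let σ' : (W →₀ B) →ₗ[B] B ⧸ J := J.mkQ ∘ₗ σ
  let τ : (W →₀ B) →ₗ[B] Q := Finsupp.linearCombination B fun a => e a • x a
  have hmul (c : W →₀ B) (a : W) : σ c * e a = c a * e a := by
    simp only [σ, Finsupp.linearCombination_apply, Finsupp.sum, smul_eq_mul, Finset.sum_mul]
    rw [Finset.sum_eq_single a]
    · rw [mul_assoc, BooleanRing.mul_self]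
    · intro b _ hb
      rw [mul_assoc, he b a hb, mul_zero]
    · intro ha
      rw [Finsupp.notMem_support_iff.mp ha, zero_mul, zero_mul]
  have hker : LinearMap.ker σ' ≤ LinearMap.ker τ := by
    intro c hc
    have hc' : σ c ∈ J := (Submodule.Quotient.mk_eq_zero J).mp hc
    rw [LinearMap.mem_ker, Finsupp.linearCombination_apply]
    refine Finset.sum_eq_zero fun a _ => ?_
    change c a • e a • x a = 0
    rw [← mul_smul, ← hmul]
    exact hJ _ (J.mul_mem_right _ hc') a
  obtain ⟨h, hh⟩ := hQ.out ((LinearMap.ker σ').liftQ σ' le_rfl)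
    (LinearMap.ker_eq_bot.mp (Submodule.ker_liftQ_eq_bot' _ _ rfl))
    ((LinearMap.ker σ').liftQ τ hker)
  refine ⟨h (J.mkQ 1), fun c hc => ?_, fun a => ?_⟩
  · rw [← map_smul, ← map_smul, smul_eq_mul, mul_one, Submodule.mkQ_apply,
      (Submodule.Quotient.mk_eq_zero J).mpr (Ideal.subset_span hc), map_zero]
  · have := hh ((LinearMap.ker σ').mkQ (Finsupp.single a 1))
    simp only [Submodule.mkQ_apply, Submodule.liftQ_apply, σ', τ, σ, LinearMap.comp_apply,
      Finsupp.linearCombination_single, one_smul] at this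
    rw [← this, ← map_smul]
    congr 1
    rw [Submodule.mkQ_apply, ← Submodule.Quotient.mk_smul, smul_eq_mul, mul_one]

variable {W : ℕ → Type u}

/-- The element `y` is annihilated by the first `n` families of elements of the ring. -/
def IsKilled (e : ∀ i, W i → B) (n : ℕ) {Q : Type u} [AddCommGroup Q] [Module B Q] (y : Q) : Prop :=
  ∀ i < n, ∀ a, e i a • y = 0

section IsKilled

variable {e : ∀ i, W i → B} {n : ℕ} {Q Q' : Type u} [AddCommGroup Q] [Module B Q] [AddCommGroup Q']
  [Module B Q'] {y z : Q}

theorem IsKilled.sub (hy : IsKilled e n y) (hz : IsKilled e n z) : IsKilled e n (y - z) :=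
  fun i hi a => by rw [smul_sub, hy i hi, hz i hi, sub_zero]

theorem IsKilled.smul (hy : IsKilled e n y) (b : B) : IsKilled e n (b • y) :=
  fun i hi a => by rw [smul_comm, hy i hi, smul_zero]

theorem IsKilled.map (hy : IsKilled e n y) (f : Q →ₗ[B] Q') : IsKilled e n (f y) :=
  fun i hi a => by rw [← map_smul, hy i hi, map_zero]

theorem IsKilled.of_map {f : Q →ₗ[B] Q'} (hf : Function.Injective f) (hy : IsKilled e n (f y)) :
    IsKilled e n y :=
  fun i hi a => hf (by rw [map_smul, hy i hi, map_zero])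

theorem IsKilled.mono {m : ℕ} (hy : IsKilled e n y) (h : m ≤ n) : IsKilled e m y :=
  fun i hi a => hy i (hi.trans_le h) a

theorem IsKilled.succ (hy : IsKilled e n y) (h : ∀ a, e n a • y = 0) : IsKilled e (n + 1) y :=
  fun i hi a => by
    rcases (Nat.lt_succ_iff.mp hi).lt_or_eq with hi | rfl
    · exact hy i hi a
    · exact h a

theorem exists_glue_isKilled (hQ : Module.Injective B Q) (n : ℕ)
    (he : ∀ a b, a ≠ b → e n a * e n b = 0) (x : W n → Q) (hx : ∀ a, IsKilled e n (x a)) :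
    ∃ q : Q, IsKilled e n q ∧ ∀ a, e n a • q = e n a • x a := by
  obtain ⟨q, hq, hq'⟩ := exists_glue hQ (e n) he {c | ∃ i < n, ∃ a, c = e i a} x (by
    rintro _ ⟨i, hi, a, rfl⟩ b
    exact hx b i hi a)
  exact ⟨q, fun i hi a => hq _ ⟨i, hi, a, rfl⟩, hq'⟩

end IsKilled

section Represents

variable {e : ∀ i, W i → B} (he : ∀ i a b, a ≠ b → e i a * e i b = 0)

-- Each `e n a • q` comes from the kernel. Lifting these elements one degree lower and gluing the
-- lifts yields a correction of `q`. Each family costs one degree, hence `n ≤ k`.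
include he in
theorem exists_isKilled_lift (M : ModuleCat.{u} B) {n k : ℕ} (hk : n ≤ k)
    (z : M.cosyzygy (k + 1)) (hz : IsKilled e n z) :
    ∃ q : M.cosyzygyHull k, IsKilled e n q ∧ M.cosyzygyProj k q = z := by
  induction n generalizing k with
  | zero =>
    obtain ⟨q, hq⟩ := M.cosyzygyProj_surjective k z
    exact ⟨q, fun i hi => absurd hi (Nat.not_lt_zero i), hq⟩
  | succ n ih =>
    obtain ⟨q, hq, hqz⟩ := ih (Nat.le_of_succ_le hk) z (hz.mono n.le_succ)
    obtain ⟨k, rfl⟩ : ∃ l, k = l + 1 := ⟨k - 1, by omega⟩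
    have h (a : W n) : ∃ y, M.cosyzygyIncl (k + 1) y = e n a • q := by
      refine (M.cosyzygy_exact (k + 1) _).mp ?_
      rw [map_smul, hqz, hz n n.lt_succ_self]
    choose y hy using h
    have hyk (a : W n) : IsKilled e n (y a) :=
      .of_map (M.cosyzygyIncl_injective _) (hy a ▸ hq.smul _)
    choose p hp hpy using fun a => ih (Nat.le_of_succ_le_succ hk) (y a) (hyk a)
    obtain ⟨r, hr, hrp⟩ := exists_glue_isKilled (M.cosyzygyHull_injective k) n (he n) p hp
    refine ⟨q - M.cosyzygyIncl (k + 1) (M.cosyzygyProj k r),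
      (hq.sub ((hr.map _).map _)).succ fun a => ?_, ?_⟩
    · rw [smul_sub, ← map_smul, ← map_smul, hrp, map_smul, map_smul, hpy, hy, ← mul_smul,
        BooleanRing.mul_self, sub_self]
    · rw [map_sub, hqz, (M.cosyzygy_exact (k + 1)).apply_apply_eq_zero, sub_zero]

/-- A function of the first `n` coordinates of a point represents a class of degree `n`, that is an
element of the `n`-th cosyzygy, when the latter is obtained by gluing along the families of
idempotents one after the other. -/
def Represents (e : ∀ i, W i → B) (x₀ : ∀ i, W i) (M : ModuleCat.{u} B) :
    ∀ n, ((∀ i, W i) → M) → M.cosyzygy n → Prop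
  | 0, f, y => y = f x₀
  | n + 1, f, z => ∃ (q : M.cosyzygyHull n) (x : W n → M.cosyzygy n), IsKilled e n q ∧
      M.cosyzygyProj n q = z ∧
      (∀ a, Represents e x₀ M n (fun p => f (Function.update p n a)) (x a)) ∧
      ∀ a, e n a • q = e n a • M.cosyzygyIncl n (x a)

variable {x₀ : ∀ i, W i} {M : ModuleCat.{u} B} {n : ℕ}

theorem Represents.sub {f f' : (∀ i, W i) → M} {y y' : M.cosyzygy n}
    (h : Represents e x₀ M n f y) (h' : Represents e x₀ M n f' y') :
    Represents e x₀ M n (fun p => f p - f' p) (y - y') := by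
  induction n generalizing f f' with
  | zero =>
    have h : y = f x₀ := h
    have h' : y' = f' x₀ := h'
    change y - y' = f x₀ - f' x₀
    rw [h, h']
    rfl
  | succ n ih =>
    obtain ⟨q, x, hq, hz, hx, hqx⟩ := h
    obtain ⟨q', x', hq', hz', hx', hqx'⟩ := h'
    exact ⟨q - q', fun a => x a - x' a, hq.sub hq', by rw [map_sub, hz, hz'],
      fun a => ih (hx a) (hx' a), fun a => by rw [smul_sub, hqx, hqx', map_sub, smul_sub]⟩

theorem Represents.smul {f : (∀ i, W i) → M} {y : M.cosyzygy n} (h : Represents e x₀ M n f y)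
    (b : B) : Represents e x₀ M n (fun p => b • f p) (b • y) := by
  induction n generalizing f with
  | zero =>
    have h : y = f x₀ := h
    change b • y = b • f x₀
    rw [h]
    rfl
  | succ n ih =>
    obtain ⟨q, x, hq, hz, hx, hqx⟩ := h
    exact ⟨b • q, fun a => b • x a, hq.smul b, by rw [map_smul, hz], fun a => ih (hx a),
      fun a => by rw [smul_comm, hqx, map_smul, smul_comm]⟩

theorem Represents.congr {f f' : (∀ i, W i) → M} {y : M.cosyzygy n} (h : Represents e x₀ M n f y)
    (hf : ∀ p : ∀ i, W i, (∀ i ≥ n, p i = x₀ i) → f p = f' p) : Represents e x₀ M n f' y := by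
  induction n generalizing f f' with
  | zero =>
    have h : y = f x₀ := h
    exact h.trans (hf x₀ fun _ _ => rfl)
  | succ n ih =>
    obtain ⟨q, x, hq, hz, hx, hqx⟩ := h
    refine ⟨q, x, hq, hz, fun a => ih (hx a) fun p hp => hf _ fun i hi => ?_, hqx⟩
    rw [Function.update_of_ne (by omega), hp i (by omega)]

include he in
theorem exists_represents (x₀ : ∀ i, W i) (f : (∀ i, W i) → M) (n : ℕ) :
    ∃ y : M.cosyzygy n, IsKilled e n y ∧ Represents e x₀ M n f y := by
  induction n generalizing f with
  | zero => exact ⟨f x₀, fun i hi => absurd hi (Nat.not_lt_zero i), rfl⟩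
  | succ n ih =>
    choose x hx hfx using fun a => ih fun p => f (Function.update p n a)
    obtain ⟨q, hq, hqx⟩ := exists_glue_isKilled (M.cosyzygyHull_injective n) n (he n)
      (fun a => M.cosyzygyIncl n (x a)) fun a => (hx a).map _
    refine ⟨M.cosyzygyProj n q, (hq.map _).succ fun a => ?_, q, x, hq, rfl, hfx, hqx⟩
    rw [← map_smul, hqx, map_smul, (M.cosyzygy_exact n).apply_apply_eq_zero, smul_zero]

include he in
theorem IsKilled.exists_represents (x₀ : ∀ i, W i) {y : M.cosyzygy n} (hy : IsKilled e n y) :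
    ∃ f, Represents e x₀ M n f y := by
  induction n with
  | zero => exact ⟨fun _ => y, rfl⟩
  | succ n ih =>
    obtain ⟨q, hq, hqy⟩ := exists_isKilled_lift he M le_rfl y (hy.mono n.le_succ)
    have h (a : W n) : ∃ x, M.cosyzygyIncl n x = e n a • q := by
      refine (M.cosyzygy_exact n _).mp ?_
      rw [map_smul, hqy, hy n n.lt_succ_self]
    choose x hx using h
    have hxk (a : W n) : IsKilled e n (x a) :=
      .of_map (M.cosyzygyIncl_injective _) (hx a ▸ hq.smul _)
    choose f hf using fun a => ih (hxk a)
    -- Coordinate `n` selects the slice; it is then reset to its base value, because degree `n` only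
    -- sees points based at `x₀` from `n` on.
    refine ⟨fun p => f (p n) (Function.update p n (x₀ n)), q, x, hq, hqy,
      fun a => (hf a).congr fun p hp => ?_, fun a => ?_⟩
    · dsimp only
      rw [Function.update_self, Function.update_idem, ← hp n le_rfl, Function.update_eq_self]
    · rw [hx, ← mul_smul, BooleanRing.mul_self]

-- Injectivity splits the sequence, so the represented class has a lift `q₁` killed by all `n + 1`
-- families; subtracting it leaves every `e n a • q` unchanged.
include he in
theorem represents_zero_of_injective (x₀ : ∀ i, W i) (hM : Module.Injective B (M.cosyzygy n))
    (f : (∀ i, W i) → M) : Represents e x₀ M (n + 1) f 0 := by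
  obtain ⟨z, hz, q, x, hq, hqz, hx, hqx⟩ := exists_represents he x₀ f (n + 1)
  obtain ⟨r, hr⟩ := hM.out (M.cosyzygyIncl n) (M.cosyzygyIncl_injective n) LinearMap.id
  obtain ⟨q', rfl⟩ := M.cosyzygyProj_surjective n z
  let q₁ := q' - M.cosyzygyIncl n (r q')
  have hq₁ : IsKilled e (n + 1) q₁ := fun i hi a => by
    obtain ⟨y, hy⟩ : ∃ y, M.cosyzygyIncl n y = e i a • q' :=
      (M.cosyzygy_exact n _).mp (by rw [map_smul, hz i hi])
    rw [smul_sub, ← map_smul, ← map_smul, ← hy, hr, LinearMap.id_apply, sub_self]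
  have hπ : M.cosyzygyProj n q₁ = M.cosyzygyProj n q' := by
    rw [map_sub, (M.cosyzygy_exact n).apply_apply_eq_zero, sub_zero]
  refine ⟨q - q₁, x, hq.sub (hq₁.mono n.le_succ), by rw [map_sub, hqz, hπ, sub_self], hx,
    fun a => ?_⟩
  rw [smul_sub, hq₁ n n.lt_succ_self, sub_zero, hqx]

-- A witness `q` over zero comes from some `y` in degree `n`. A function representing `y` supplies
-- the summand ignoring coordinate `n`; what remains of each slice, multiplied by `e n a`,
-- represents zero one degree lower.
include he in
theorem Represents.exists_eq_sum {f : (∀ i, W i) → M} (h : Represents e x₀ M n f 0) :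
    ∃ g : ℕ → (∀ i, W i) → M, (∀ i < n, ∀ p a, g i (Function.update p i a) = g i p) ∧
      ∀ p : ∀ i, W i, (∀ i ≥ n, p i = x₀ i) →
        (∏ i ∈ Finset.range n, e i (p i)) • f p =
          (∏ i ∈ Finset.range n, e i (p i)) • ∑ i ∈ Finset.range n, g i p := by
  induction n generalizing f with
  | zero =>
    refine ⟨fun _ _ => 0, fun i hi => absurd hi (Nat.not_lt_zero i), fun p hp => ?_⟩
    have h : (0 : M) = f x₀ := h
    obtain rfl : p = x₀ := funext fun i => hp i (Nat.zero_le i)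
    simp [← h]
  | succ n ih =>
    obtain ⟨q, x, hq, hz, hx, hqx⟩ := h
    obtain ⟨y, rfl⟩ := (M.cosyzygy_exact n q).mp hz
    have hy : IsKilled e n y := hq.of_map (M.cosyzygyIncl_injective n)
    obtain ⟨g₀, hg₀⟩ := hy.exists_represents he x₀
    have hyx (a : W n) : e n a • (x a - y) = 0 := by
      apply M.cosyzygyIncl_injective n
      rw [map_smul, map_sub, smul_sub, hqx, sub_self, map_zero]
    choose g hg hgf using fun a => ih (hyx a ▸ ((hx a).sub hg₀).smul (e n a))
    refine ⟨fun i p => if i = n then g₀ (Function.update p n (x₀ n)) else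
      g (p n) i (Function.update p n (x₀ n)), fun i hi p a => ?_, fun p hp => ?_⟩
    · rcases eq_or_ne i n with rfl | hin
      · simp
      · simp only [if_neg hin, Function.update_of_ne hin.symm]
        rw [Function.update_comm hin, hg _ i (by omega)]
    · have key := hgf (p n) (Function.update p n (x₀ n)) fun i hi => by
        rcases eq_or_ne i n with rfl | hin
        · simp
        · rw [Function.update_of_ne hin, hp i (by omega)]
      have hprod : ∏ i ∈ Finset.range n, e i (Function.update p n (x₀ n) i) =
          ∏ i ∈ Finset.range n, e i (p i) :=
        Finset.prod_congr rfl fun i hi => by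
          rw [Function.update_of_ne (Finset.mem_range.mp hi).ne]
      rw [hprod, Function.update_idem, Function.update_eq_self] at key
      have hsum : ∑ i ∈ Finset.range (n + 1), (if i = n then g₀ (Function.update p n (x₀ n)) else
          g (p n) i (Function.update p n (x₀ n))) =
          ∑ i ∈ Finset.range n, g (p n) i (Function.update p n (x₀ n)) +
            g₀ (Function.update p n (x₀ n)) := by
        rw [Finset.sum_range_succ, if_pos rfl]
        congr 1
        exact Finset.sum_congr rfl fun i hi => if_neg (Finset.mem_range.mp hi).ne
      rw [hsum, Finset.prod_range_succ, smul_add, mul_comm _ (e n (p n)), mul_smul _ _ (Finset.sum _ _),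
        ← key, ← mul_smul, ← mul_smul, mul_right_comm, BooleanRing.mul_self,
        smul_sub, sub_add_cancel]

include he in
/-- If a module over a Boolean ring has injective dimension at most `n`, then every function on the product of
`n + 1` index sets is, locally, a sum of functions that each ignore one of the coordinates. -/
theorem exists_eq_sum_of_hasInjectiveDimensionLT (x₀ : ∀ i, W i)
    (hM : HasInjectiveDimensionLT M (n + 1)) (f : (∀ i, W i) → M) :
    ∃ g : ℕ → (∀ i, W i) → M, (∀ i < n + 1, ∀ p a, g i (Function.update p i a) = g i p) ∧
      ∀ p : ∀ i, W i, (∀ i ≥ n + 1, p i = x₀ i) →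
        (∏ i ∈ Finset.range (n + 1), e i (p i)) • f p =
          (∏ i ∈ Finset.range (n + 1), e i (p i)) • ∑ i ∈ Finset.range (n + 1), g i p :=
  (represents_zero_of_injective he x₀
    ((M.hasInjectiveDimensionLT_iff_injective_cosyzygy n).mp hM) f).exists_eq_sum he

end Represents

end BooleanRing

/-! ### Cardinal obstruction to decomposing a product -/

section Combinatorics

variable {V : ℕ → Type u}

theorem mk_eventually_eq_lt (hV : ∀ i, #(V i) = ℵ_ i) (x₀ : ∀ i, V i ⊕ V i) (n : ℕ) :
    #{p : ∀ i, V i ⊕ V i // ∀ i ≥ n, p i = x₀ i} < ℵ_ n := by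
  induction n with
  | zero =>
    rw [Nat.cast_zero, aleph_zero, lt_aleph0_iff_finite]
    have : Subsingleton {p : ∀ i, V i ⊕ V i // ∀ i ≥ 0, p i = x₀ i} :=
      ⟨fun p q => Subtype.ext (funext fun i => (p.2 i i.zero_le).trans (q.2 i i.zero_le).symm)⟩
    infer_instance
  | succ n ih =>
    let F : {p : ∀ i, V i ⊕ V i // ∀ i ≥ n + 1, p i = x₀ i} →
        {p : ∀ i, V i ⊕ V i // ∀ i ≥ n, p i = x₀ i} × (V n ⊕ V n) := fun p =>
      (⟨Function.update p.1 n (x₀ n), fun i hi => by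
        rcases eq_or_ne i n with rfl | hin
        · simp
        · rw [Function.update_of_ne hin, p.2 i (by omega)]⟩, p.1 n)
    have hF : Function.Injective F := by
      intro p q h
      have h₁ := congrArg Subtype.val (Prod.ext_iff.mp h).1
      have h₂ : p.1 n = q.1 n := (Prod.ext_iff.mp h).2
      ext i
      rcases eq_or_ne i n with rfl | hin
      · exact h₂
      · simpa [F, Function.update_of_ne hin] using congrFun h₁ i
    refine (mk_le_of_injective hF).trans_lt ?_
    rw [Nat.cast_succ, ← succ_aleph, Order.lt_succ_iff, mk_prod, lift_id, lift_id, mk_sum, lift_id,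
      hV, add_eq_self (aleph0_le_aleph _)]
    exact (mul_le_mul' ih.le le_rfl).trans (mul_eq_self (aleph0_le_aleph _)).le

theorem mk_iUnion_finite_lt {ι α : Type u} {c : Cardinal.{u}} (hc : ℵ₀ ≤ c) (hι : #ι < c)
    (s : ι → Set α) (hs : ∀ i, (s i).Finite) : #(⋃ i, s i) < c := by
  rcases finite_or_infinite ι with h | h
  · exact (lt_aleph0_iff_finite.mpr (Set.finite_iUnion hs)).trans_le hc
  · refine (mk_iUnion_le_sum_mk.trans
      (sum_le_sum _ (fun _ => ℵ₀) fun i => (lt_aleph0_iff_finite.mpr (hs i)).le)).trans_lt ?_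
    rw [sum_const', mul_aleph0_eq (aleph0_le_mk ι)]
    exact hι

/-- The product of indicator functions of moieties on a product of sets of cardinalities
`ℵ₀, …, ℵ_(n-1)` is not a sum of functions, the `i`-th of which is almost constant in the direction
of the `i`-th coordinate. -/
theorem not_forall_sum_eq_prod {R : Type*} [CommRing R] [Nontrivial R]
    (hV : ∀ i, #(V i) = ℵ_ i) (x₀ : ∀ i, V i ⊕ V i) (n : ℕ) (h : ℕ → (∀ i, V i ⊕ V i) → R)
    (hh : ∀ i < n, ∀ p, ∃ c, {a | h i (Function.update p i a) ≠ c}.Finite) :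
    ¬ ∀ p : ∀ i, V i ⊕ V i, (∀ i ≥ n, p i = x₀ i) →
      ∑ i ∈ Finset.range n, h i p = ∏ i ∈ Finset.range n, if (p i).isLeft then 1 else 0 := by
  induction n generalizing h with
  | zero => exact fun H => by simpa using H x₀ fun _ _ => rfl
  | succ n ih =>
    intro H
    choose c hc using hh n n.lt_succ_self
    let bad : Set (V n ⊕ V n) :=
      ⋃ p : {p : ∀ i, V i ⊕ V i // ∀ i ≥ n, p i = x₀ i}, {a | h n (Function.update p.1 n a) ≠ c p}
    have hbad : #bad < #(V n) := by
      rw [hV]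
      exact mk_iUnion_finite_lt (aleph0_le_aleph _) (mk_eventually_eq_lt hV x₀ n) _ fun p => hc p
    have hex (j : V n → V n ⊕ V n) (hj : Function.Injective j) : ∃ v, j v ∉ bad := by
      by_contra! hcon
      exact hbad.not_ge (mk_le_of_injective (f := fun v => (⟨j v, hcon v⟩ : bad)) fun v w hvw =>
        hj (congrArg Subtype.val hvw))
    obtain ⟨v, hv⟩ := hex Sum.inl Sum.inl_injective
    obtain ⟨w, hw⟩ := hex Sum.inr Sum.inr_injective
    have hgood {a : V n ⊕ V n} (ha : a ∉ bad) (p : ∀ i, V i ⊕ V i) (hp : ∀ i ≥ n, p i = x₀ i) :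
        h n (Function.update p n a) = c p := by
      by_contra hne
      exact ha (Set.mem_iUnion.mpr ⟨⟨p, hp⟩, hne⟩)
    have hval (a : V n ⊕ V n) (ha : a ∉ bad) (p : ∀ i, V i ⊕ V i) (hp : ∀ i ≥ n, p i = x₀ i) :
        ∑ i ∈ Finset.range n, h i (Function.update p n a) =
          (∏ i ∈ Finset.range n, if (p i).isLeft then 1 else 0) * (if a.isLeft then 1 else 0) -
            c p := by
      have := H (Function.update p n a) fun i hi => by
        rw [Function.update_of_ne (by omega), hp i (by omega)]
      rw [Finset.sum_range_succ, hgood ha p hp, Finset.prod_range_succ, Function.update_self] at this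
      rw [eq_sub_iff_add_eq.mpr this]
      congr 2
      exact Finset.prod_congr rfl fun i hi => by
        rw [Function.update_of_ne (Finset.mem_range.mp hi).ne]
    -- At the good values `v` and `w` the last summand is the same `c p`, so it cancels, while the
    -- last factor of the product contributes `1 - 0`.
    refine ih (fun i p => h i (Function.update p n (.inl v)) - h i (Function.update p n (.inr w)))
      (fun i hi p => ?_) fun p hp => ?_
    · obtain ⟨c₁, h₁⟩ := hh i (by omega) (Function.update p n (.inl v))
      obtain ⟨c₂, h₂⟩ := hh i (by omega) (Function.update p n (.inr w))
      refine ⟨c₁ - c₂, (h₁.union h₂).subset fun a ha => ?_⟩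
      by_contra hcon
      rw [Set.mem_union, not_or] at hcon
      have e₁ := not_not.mp hcon.1
      have e₂ := not_not.mp hcon.2
      rw [Function.update_comm hi.ne'] at e₁ e₂
      exact ha (by rw [e₁, e₂])
    · rw [Finset.sum_sub_distrib, hval _ hv p hp, hval _ hw p hp]
      simp

end Combinatorics

/-! ### The coordinate algebras and their size -/

section Example

variable {V : ℕ → Type u}

/-- The algebra of functions on a product generated by the indicator functions of the points of the
factors indexed by `S`. -/
def coordinateAlgebra (V : ℕ → Type u) (S : Set ℕ) :
    Subalgebra (ZMod 2) ((∀ i, V i ⊕ V i) → ZMod 2) :=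
  Algebra.adjoin (ZMod 2) (Set.range fun (x : Σ i : S, V i ⊕ V i) =>
    Set.indicator {p | p x.1 = x.2} 1)

namespace coordinateAlgebra

variable {S : Set ℕ}

instance : BooleanRing (coordinateAlgebra V S) where
  isIdempotentElem b := Subtype.ext (funext fun p => by
    change b.1 p * b.1 p = b.1 p
    generalize b.1 p = z
    revert z
    decide)

open Classical in
/-- The indicator functions of the points of a factor, replaced by zero for the factors that are not
indexed by `S`. -/
noncomputable def point (i : ℕ) (a : V i ⊕ V i) : coordinateAlgebra V S :=
  if hi : i ∈ S then
    ⟨Set.indicator {p | p i = a} 1, Algebra.subset_adjoin ⟨⟨⟨i, hi⟩, a⟩, rfl⟩⟩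
  else 0

theorem coe_point {i : ℕ} (hi : i ∈ S) (a : V i ⊕ V i) :
    ((point i a : coordinateAlgebra V S) : (∀ i, V i ⊕ V i) → ZMod 2) =
      Set.indicator {p | p i = a} 1 := by
  rw [point, dif_pos hi]

theorem point_mul_point (i : ℕ) (a b : V i ⊕ V i) (h : a ≠ b) :
    (point i a * point i b : coordinateAlgebra V S) = 0 := by
  by_cases hi : i ∈ S
  · ext p
    change (point i a : coordinateAlgebra V S).1 p * (point i b : coordinateAlgebra V S).1 p = 0
    rw [coe_point hi, coe_point hi]
    by_cases hp : p i = a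
    · simp [Set.indicator, hp, h]
    · simp [Set.indicator, hp]
  · rw [point, dif_neg hi, zero_mul]

/-- Along coordinate `i` a generator is constant or vanishes off one point, and almost constancy
survives sums and products. -/
theorem exists_finite_ne (b : coordinateAlgebra V S) (i : ℕ) (p : ∀ i, V i ⊕ V i) :
    ∃ c, {a | b.1 (Function.update p i a) ≠ c}.Finite := by
  have aux (F : ZMod 2 → ZMod 2 → ZMod 2) (x y : (∀ i, V i ⊕ V i) → ZMod 2)
      (hx : ∃ c, {a | x (Function.update p i a) ≠ c}.Finite)
      (hy : ∃ c, {a | y (Function.update p i a) ≠ c}.Finite) :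
      ∃ c, {a | F (x (Function.update p i a)) (y (Function.update p i a)) ≠ c}.Finite := by
    obtain ⟨c, hc⟩ := hx
    obtain ⟨d, hd⟩ := hy
    refine ⟨F c d, (hc.union hd).subset fun a ha => ?_⟩
    by_contra hcon
    rw [Set.mem_union, not_or] at hcon
    exact ha (by rw [not_not.mp hcon.1, not_not.mp hcon.2])
  obtain ⟨b, hb⟩ := b
  induction hb using Algebra.adjoin_induction with
  | mem x hx =>
    obtain ⟨⟨⟨j, hj⟩, a⟩, rfl⟩ := hx
    rcases eq_or_ne j i with rfl | hji
    · refine ⟨0, (Set.finite_singleton a).subset fun a' ha' => ?_⟩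
      by_contra hne
      exact ha' (Set.indicator_of_notMem (by simpa using hne) _)
    · refine ⟨Set.indicator {p | p j = a} 1 p, Set.finite_empty.subset fun a' ha' => ha' ?_⟩
      have : Function.update p i a' j = p j := Function.update_of_ne hji _ _
      change Set.indicator {q : ∀ i, V i ⊕ V i | q j = a} 1 (Function.update p i a') = _
      have hmem : Function.update p i a' ∈ {q : ∀ i, V i ⊕ V i | q j = a} ↔
          p ∈ {q : ∀ i, V i ⊕ V i | q j = a} := by
        change Function.update p i a' j = a ↔ p j = a
        rw [this]
      by_cases h : p ∈ {q : ∀ i, V i ⊕ V i | q j = a}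
      · rw [Set.indicator_of_mem (hmem.mpr h), Set.indicator_of_mem h]
        rfl
      · rw [Set.indicator_of_notMem (mt hmem.mp h), Set.indicator_of_notMem h]
  | algebraMap r => exact ⟨r, Set.finite_empty.subset fun a ha => ha rfl⟩
  | add x y _ _ hx hy => exact aux (· + ·) x y hx hy
  | mul x y _ _ hx hy => exact aux (· * ·) x y hx hy

theorem not_hasInjectiveDimensionLT (hV : ∀ i, #(V i) = ℵ_ i) (n : ℕ) (hS : ∀ i ≤ n, i ∈ S) :
    ¬ HasInjectiveDimensionLT
      (ModuleCat.of.{u} (coordinateAlgebra V S) (coordinateAlgebra V S)) (n + 1) := by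
  intro hM
  have hne (i : ℕ) : Nonempty (V i ⊕ V i) := by
    have : Nonempty (V i) := mk_ne_zero_iff.mp (by rw [hV]; exact (aleph_pos _).ne')
    infer_instance
  let x₀ : ∀ i, V i ⊕ V i := fun i => (hne i).some
  obtain ⟨g, hg, hfg⟩ := BooleanRing.exists_eq_sum_of_hasInjectiveDimensionLT
    (e := fun i => (point i : V i ⊕ V i → coordinateAlgebra V S)) point_mul_point x₀ hM
    fun p => ∏ i ∈ Finset.range (n + 1), if (p i).isLeft then 1 else 0
  change ℕ → (∀ i, V i ⊕ V i) → coordinateAlgebra V S at g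
  refine not_forall_sum_eq_prod hV x₀ (n + 1) (fun i p => (g i p).1 p) (fun i hi p => ?_)
    fun p hp => ?_
  · obtain ⟨c, hc⟩ := exists_finite_ne (g i p) i p
    refine ⟨c, ?_⟩
    simp only [hg i hi]
    exact hc
  -- Evaluation at `p` sends the product of the idempotents `point i (p i)` to `1`, so the local
  -- identity becomes an equation in `ZMod 2`.
  · let φ : coordinateAlgebra V S →+* ZMod 2 :=
      (Pi.evalRingHom _ p).comp (coordinateAlgebra V S).val.toRingHom
    have hφ (b : coordinateAlgebra V S) : φ b = b.1 p := rfl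
    have key := congrArg φ (hfg p hp)
    have hone : φ (∏ i ∈ Finset.range (n + 1), point i (p i)) = 1 := by
      rw [map_prod]
      refine Finset.prod_eq_one fun i hi => ?_
      rw [hφ, coe_point (hS i (Nat.lt_succ_iff.mp (Finset.mem_range.mp hi)))]
      simp
    rw [smul_eq_mul, smul_eq_mul, map_mul, map_mul, hone, one_mul, one_mul, map_sum, map_prod] at key
    simp only [apply_ite φ, map_one, map_zero] at key
    exact key.symm

theorem mk_le (hV : ∀ i, #(V i) = ℵ_ i) {c : Cardinal.{u}} (hc : ℵ₀ ≤ c)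
    (hS : ∀ i ∈ S, ℵ_ (i : Ordinal.{u}) ≤ c) : #(coordinateAlgebra V S) ≤ c := by
  have h := Algebra.lift_cardinalMk_adjoin_le (ZMod 2)
    (Set.range fun (x : Σ i : S, V i ⊕ V i) =>
      (Set.indicator {p | p x.1 = x.2} 1 : (∀ i, V i ⊕ V i) → ZMod 2))
  rw [lift_id'.{0, u}] at h
  refine h.trans (sup_le (sup_le ?_ ?_) hc)
  · exact (lift_lt_aleph0.mpr (lt_aleph0_of_finite (ZMod 2))).le.trans hc
  · rw [lift_id'.{0, u}]
    refine mk_range_le.trans ?_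
    rw [mk_sigma]
    have hs (i : S) : #(V i ⊕ V i) ≤ c := by
      rw [mk_sum, lift_id, hV, add_eq_self (aleph0_le_aleph _)]
      exact hS i i.2
    refine (sum_le_sum _ (fun _ => c) hs).trans ?_
    rw [sum_const, lift_id'.{0, u}]
    exact (mul_le_mul' ((lift_le.mpr mk_le_aleph0).trans lift_aleph0.le |>.trans hc) le_rfl).trans
      (mul_eq_self hc).le

theorem le_mk (hV : ∀ i, #(V i) = ℵ_ i) {i : ℕ} (hi : i ∈ S) :
    ℵ_ (i : Ordinal.{u}) ≤ #(coordinateAlgebra V S) := by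
  have hne (i : ℕ) : Nonempty (V i ⊕ V i) := by
    have : Nonempty (V i) := mk_ne_zero_iff.mp (by rw [hV]; exact (aleph_pos _).ne')
    infer_instance
  rw [← hV i]
  refine mk_le_of_injective (f := fun v => point i (Sum.inl v)) fun v w hvw => ?_
  have h := congrFun (congrArg Subtype.val hvw)
    (Function.update (fun i => (hne i).some) i (Sum.inl v))
  by_contra hne
  simp [coe_point hi, Set.indicator, hne] at h

end coordinateAlgebra

end Example

theorem theorem2 :
    (∀ n : ℕ, ∃ (B : Type u) (_ : BooleanRing B),
      Cardinal.mk B = Cardinal.aleph (n : Ordinal.{u}) ∧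
      CategoryTheory.injectiveDimension (ModuleCat.of.{u} B B) =
        ((n + 1 : ℕ) : WithBot ℕ∞)) ∧
    (∃ (B : Type u) (_ : BooleanRing B),
      Cardinal.mk B = Cardinal.aleph Ordinal.omega0.{u} ∧
      CategoryTheory.injectiveDimension (ModuleCat.of.{u} B B) = ⊤) := by
  let V : ℕ → Type u := fun i => (ℵ_ (i : Ordinal.{u})).out
  have hV (i : ℕ) : #(V i) = ℵ_ i := mk_out _
  refine ⟨fun n => ⟨coordinateAlgebra V {i | i ≤ n}, inferInstance, ?_⟩,
    coordinateAlgebra V Set.univ, inferInstance, le_antisymm ?_ ?_, ?_⟩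
  · have hcard : #(coordinateAlgebra V {i | i ≤ n}) = ℵ_ n :=
      le_antisymm (coordinateAlgebra.mk_le hV (aleph0_le_aleph _) fun i hi =>
        aleph_le_aleph.mpr (Nat.cast_le.mpr hi)) (coordinateAlgebra.le_mk hV (le_refl n))
    refine ⟨hcard, le_antisymm (BooleanRing.injectiveDimension_le_of_mk_le n hcard.le _) ?_⟩
    exact (injectiveDimension_ge_iff _ (n + 1)).mpr
      (coordinateAlgebra.not_hasInjectiveDimensionLT hV n fun i hi => hi)
  · exact coordinateAlgebra.mk_le hV (aleph0_le_aleph _) fun i _ =>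
      aleph_le_aleph.mpr (Ordinal.natCast_lt_omega0 i).le
  · rw [aleph_limit Ordinal.isSuccLimit_omega0]
    refine ciSup_le' fun ⟨a, ha⟩ => ?_
    obtain ⟨i, rfl⟩ := Ordinal.lt_omega0.mp ha
    exact coordinateAlgebra.le_mk hV (Set.mem_univ i)
  · by_contra h
    obtain ⟨n, hn⟩ := (injectiveDimension_ne_top_iff _).mp h
    exact coordinateAlgebra.not_hasInjectiveDimensionLT hV n (fun i _ => Set.mem_univ i) hn
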